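/- **Lemma.** Let $H$ be a complex random variable with $\mathbb{E}|H|^2=1$, let $S_T$ (the channel state information at the transmitter) and $S_R$ (the channel state information at the receiver) be random variables with arbitrary alphabets $\mathcal S_T$, $\mathcal S_R$, where $(H,S_T,S_R)$ may have an arbitrary joint distribution, and put $G=|H|^2$. An adaptive symbol $A$ is a random function $X_A(\cdot):\mathcal S_T\to\mathbb{C}$ with an arbitrary distribution; the channel input is $X=X_A(S_T)$, and the fading channel with AWGN has the output $$Y = HX+Z,\qquad Z\sim\mathcal{CN}(0,1),$$ where $A$, $(H,S_T,S_R)$ and $Z$ are mutually independent, and the receiver sees $[Y,S_R]$. For $P\ge 0$ the capacity (in nats) under the power constraint $\mathbb{E}|X|^2\le P$ is $$C(P)=\sup_{A:\ \mathbb{E}|X|^2\le P} I(A;Y\mid S_R),$$ where $I(A;Y\mid S_R)$ is the average mutual information of $A$ and $Y$ conditioned on $S_R$. Then $$C(P)\ \le\ \max_{P(\cdot)}\ \mathbb{E}\big[\log\big(1+G\,P(S_T)\big)\big],$$ where the maximum is over all measurable power policies $P(\cdot):\mathcal S_T\to[0,\infty)$ with $\mathbb{E}[P(S_T)]\le P$,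 and log is the natural logarithm. This maximum is attained and finite. -/

import Mathlib

open MeasureTheory ProbabilityTheory InformationTheory
open scoped ENNReal NNReal

universe u v w

noncomputable section

namespace FadingAWGN

/-- The circularly symmetric complex Gaussian law `CN(0,1)`, given by its density
`π⁻¹ exp (-|z|²)` with respect to Lebesgue measure on `ℂ`. -/
def stdCSCG : Measure ℂ :=
  (volume : Measure ℂ).withDensity
    (fun z => ENNReal.ofReal (Real.pi⁻¹ * Real.exp (-‖z‖ ^ 2)))

instance isProbabilityMeasure_stdCSCG : IsProbabilityMeasure stdCSCG := by
  have key := GaussianFourier.integral_rexp_neg_mul_sq_norm (V := ℂ) (b := 1) one_pos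
  have h1 : ∫ z : ℂ, Real.exp (-‖z‖ ^ 2) = Real.pi := by
    simpa [Complex.finrank_real_complex] using key
  have hint : Integrable (fun z : ℂ => Real.exp (-‖z‖ ^ 2)) := by
    by_contra h
    rw [integral_undef h] at h1
    exact Real.pi_ne_zero h1.symm
  constructor
  rw [stdCSCG, withDensity_apply _ MeasurableSet.univ, Measure.restrict_univ,
    ← ofReal_integral_eq_lintegral_ofReal (hint.const_mul _)
      (Filter.Eventually.of_forall fun z => by positivity),
    integral_const_mul, h1, inv_mul_cancel₀ Real.pi_ne_zero, ENNReal.ofReal_one]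

/-- The average conditional mutual information `I(A;Y|S)` in nats of random variables `A`, `Y`, `S`
on `(Ω, μ)`: the informational divergence between the joint law `P_{ASY}` and the law
`P_{AS} P_{Y|S}` under which `A - S - Y` is a Markov chain with the same laws of `(A,S)` and
`(S,Y)`. -/
def condMutualInfo {Ω 𝓐 𝓨 𝓢 : Type*} [MeasurableSpace Ω] [MeasurableSpace 𝓐]
    [MeasurableSpace 𝓨] [StandardBorelSpace 𝓨] [Nonempty 𝓨] [MeasurableSpace 𝓢]
    (μ : Measure Ω) [IsFiniteMeasure μ] (A : Ω → 𝓐) (Y : Ω → 𝓨) (S : Ω → 𝓢) : ℝ≥0∞ :=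
  klDiv (μ.map (fun ω => ((A ω, S ω), Y ω)))
    ((μ.map (fun ω => (A ω, S ω))) ⊗ₘ (Kernel.prodMkLeft 𝓐 (condDistrib Y S μ)))

variable {𝓢T : Type v} {𝓢R : Type w} [MeasurableSpace 𝓢T] [MeasurableSpace 𝓢R]

/-- A random adaptive symbol `A` (Shannon strategy): a random function from the CSIT alphabet to
the complex plane, with an arbitrary distribution.  The realizations are indexed by `a : Alphabet`;
the realization `a` is the function `X_a(·) = input a`, and `input a s` is the channel input that is
transmitted if the CSIT is `s`. -/
structure AdaptiveSymbol (𝓢T : Type v) [MeasurableSpace 𝓢T] where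
  /-- the index set of the realizations of `A` -/
  Alphabet : Type u
  [mAlphabet : MeasurableSpace Alphabet]
  /-- the distribution of `A` -/
  law : Measure Alphabet
  [isProb : IsProbabilityMeasure law]
  /-- the channel input as a function of the realization of `A` and of the CSIT -/
  input : Alphabet → 𝓢T → ℂ
  measurable_input : Measurable (Function.uncurry input)

attribute [instance] AdaptiveSymbol.mAlphabet AdaptiveSymbol.isProb

namespace AdaptiveSymbol

/-- The sample space: points are `(a, (h, sT, sR), z)`, i.e., the realizations of the adaptive
symbol, of the channel state `(H, S_T, S_R)` and of the noise `Z`. -/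
abbrev Sample (A : AdaptiveSymbol.{u, v} 𝓢T) (𝓢R : Type w) : Type (max u v w) :=
  A.Alphabet × (ℂ × 𝓢T × 𝓢R) × ℂ

/-- The joint law of `(A, (H, S_T, S_R), Z)`: these are mutually independent, `(H, S_T, S_R)` has
law `Q`, and `Z ∼ CN(0,1)`. -/
abbrev jointLaw (A : AdaptiveSymbol.{u, v} 𝓢T) (Q : Measure (ℂ × 𝓢T × 𝓢R)) :
    Measure (A.Sample 𝓢R) :=
  A.law.prod (Q.prod stdCSCG)

/-- The adaptive symbol as a random variable on the sample space. -/
def symbol (A : AdaptiveSymbol.{u, v} 𝓢T) (ω : A.Sample 𝓢R) : A.Alphabet := ω.1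

/-- The CSIR `S_R`. -/
def csir (A : AdaptiveSymbol.{u, v} 𝓢T) (ω : A.Sample 𝓢R) : 𝓢R := ω.2.1.2.2

/-- The channel input `X = X(S_T)`. -/
def X (A : AdaptiveSymbol.{u, v} 𝓢T) (ω : A.Sample 𝓢R) : ℂ := A.input ω.1 ω.2.1.2.1

/-- The channel output `Y = H X + Z`. -/
def Y (A : AdaptiveSymbol.{u, v} 𝓢T) (ω : A.Sample 𝓢R) : ℂ := ω.2.1.1 * A.X ω + ω.2.2

/-- The average transmit power `E|X|²`. -/
def power (A : AdaptiveSymbol.{u, v} 𝓢T) (Q : Measure (ℂ × 𝓢T × 𝓢R)) : ℝ≥0∞ :=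
  ∫⁻ ω, ‖A.X ω‖ₑ ^ 2 ∂(A.jointLaw Q)

end AdaptiveSymbol

/-- The capacity `C(P) = max I(A;Y|S_R)` in nats per channel use (read as a supremum in `[0,∞]`)
over all adaptive symbols `A` with `E|X|² ≤ P`, of the fading channel `Y = H X + Z` with CSIT `S_T`
and CSIR `S_R`, where `Q` is the joint law of `(H, S_T, S_R)`. -/
def capacity (Q : Measure (ℂ × 𝓢T × 𝓢R)) [IsProbabilityMeasure Q] (P : ℝ≥0) : ℝ≥0∞ :=
  ⨆ (A : AdaptiveSymbol.{u, v} 𝓢T) (_ : A.power Q ≤ P),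
    condMutualInfo (A.jointLaw Q) A.symbol A.Y A.csir

/-- The power control policies `P(·)` with `E[P(S_T)] ≤ P`. -/
def powerPolicies (Q : Measure (ℂ × 𝓢T × 𝓢R)) (P : ℝ≥0) : Set (𝓢T → ℝ≥0) :=
  {p | Measurable p ∧ ∫⁻ ω, (p ω.2.1 : ℝ≥0∞) ∂Q ≤ P}

/-- `E[log(1 + G P(S_T))]` with `G = |H|²`, as the integral of a nonnegative function. -/
def policyRate (Q : Measure (ℂ × 𝓢T × 𝓢R)) (p : 𝓢T → ℝ≥0) : ℝ≥0∞ :=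
  ∫⁻ ω, ENNReal.ofReal (Real.log (1 + ‖ω.1‖ ^ 2 * (p ω.2.1 : ℝ))) ∂Q

end FadingAWGN

end

/-! Upper bound. Write W = (H, S_T, S_R). Since A is independent of S_R, the law P_{AS}P_{Y|S} for S
= S_R is P_A × P_{SY}, the image of P_A × P_{WY} under forgetting H and S_T. Data processing
therefore bounds I(A;Y|S_R) by the divergence of P_{AWY} from P_A × P_{WY}, that is, by the
information available to a receiver that knows the whole state. By `klDiv_prod_snd_le` this does not
decrease when P_{WY} is replaced by any other law. The choice is P_W followed by a centred Gaussian
output of variance v = 1 + G p(S_T), where p(s) = E|X_A(s)|². The log-density ratio is then log v -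
|Z|² + |Y|²/v; the last two terms have means -1 and +1, so E log v remains (`klDiv_fullLaw`), and p
is a feasible policy.

Attainment. The CSIT alphabet carries no topology, so compactness is replaced by strict concavity.
The concavity deficit of the rate at a midpoint is exactly E log cosh of half the difference of the
two log-rates (`policyRate_midpoint`). Near-maximizers thus have log-rates close in probability, and
a fast maximizing sequence has almost surely convergent log-rates by Borel-Cantelli. The lower limit
of its policies is feasible by Fatou. The bound log(1 + gx)² ≤ 16(1 + g + x) makes the log-rates
uniformly integrable, so no rate is lost in the limit. -/

/-! ### Divergence from product laws and between laws with densities. -/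

namespace InformationTheory

/-- Replacing the second marginal by another law does not decrease the divergence from a product. -/
lemma klDiv_prod_snd_le {α β : Type*} [MeasurableSpace α] [MeasurableSpace β]
    (π : Measure (α × β)) [IsProbabilityMeasure π] (μ : Measure α) [IsProbabilityMeasure μ]
    (R : Measure β) [IsProbabilityMeasure R] :
    klDiv π (μ.prod π.snd) ≤ klDiv π (μ.prod R) := by
  by_cases htop : klDiv π (μ.prod R) = ∞
  · simp [htop]
  obtain ⟨hac, hint⟩ := klDiv_ne_top_iff.mp htop
  have hR : (μ.prod R).map Prod.snd = R := by simp [Measure.map_snd_prod]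
  -- Data processing makes the marginal divergence finite, so the chain rule below never subtracts
  -- infinities.
  have hle : klDiv π.snd R ≤ klDiv π (μ.prod R) := by
    have h := klDiv_map_le π (μ.prod R) measurable_snd
    rwa [hR] at h
  obtain ⟨hac', hint'⟩ := klDiv_ne_top_iff.mp (ne_top_of_le_ne_top htop hle)
  set ρ := μ.prod R with hρ
  set k := π.snd.rnDeriv R with hk
  set f := π.rnDeriv ρ with hf
  have hkm : Measurable k := Measure.measurable_rnDeriv _ _
  have hfm : Measurable f := Measure.measurable_rnDeriv _ _
  have hσ : μ.prod π.snd = ρ.withDensity (fun z => k z.2) := by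
    conv_lhs => rw [← Measure.withDensity_rnDeriv_eq _ _ hac']
    exact prod_withDensity_right hkm
  have hπ : ρ.withDensity f = π := Measure.withDensity_rnDeriv_eq _ _ hac
  have hk0 : ∀ᵐ z ∂π, k z.2 ≠ 0 := by
    have h : ∀ᵐ y ∂(π.map Prod.snd), 0 < k y := Measure.rnDeriv_pos hac'
    filter_upwards [ae_of_ae_map measurable_snd.aemeasurable h] with z hz using hz.ne'
  have hktop : ∀ᵐ z ∂ρ, k z.2 ≠ ∞ := by
    have h : ∀ᵐ y ∂(ρ.map Prod.snd), k y < ∞ := by rw [hR]; exact Measure.rnDeriv_lt_top _ _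
    filter_upwards [ae_of_ae_map measurable_snd.aemeasurable h] with z hz using hz.ne
  have hkf : ∀ᵐ z ∂ρ, f z ≠ 0 → k z.2 ≠ 0 := by
    rw [← hπ] at hk0
    exact (ae_withDensity_iff hfm).mp hk0
  have hdiv : Measurable fun z : α × β => f z / k z.2 := hfm.div (hkm.comp measurable_snd)
  have hπσ : π = (μ.prod π.snd).withDensity (fun z => f z / k z.2) := by
    rw [hσ, ← withDensity_mul (f := fun z : α × β => k z.2) _ (hkm.comp measurable_snd) hdiv]
    conv_lhs => rw [← hπ]
    refine withDensity_congr_ae ?_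
    filter_upwards [hktop, hkf] with z h1 h2
    by_cases h0 : k z.2 = 0
    · have : f z = 0 := by by_contra h; exact h2 h h0
      simp [this]
    · simp [ENNReal.mul_div_cancel h0 h1]
  have hacσ : π ≪ μ.prod π.snd := by
    conv_lhs => rw [hπσ]
    exact withDensity_absolutelyContinuous _ _
  have hrn : π.rnDeriv (μ.prod π.snd) =ᵐ[μ.prod π.snd] fun z => f z / k z.2 := by
    have h := Measure.rnDeriv_withDensity (μ.prod π.snd) hdiv
    rwa [← hπσ] at h
  -- Pointwise chain rule: the divergence from μ × R exceeds that from μ × π.snd by the divergence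
  -- of π.snd from R, which is nonnegative.
  have hllr : llr π (μ.prod π.snd) =ᵐ[π] fun z => llr π ρ z - llr π.snd R z.2 := by
    have hfpos : ∀ᵐ z ∂π, 0 < f z := Measure.rnDeriv_pos hac
    have hftop : ∀ᵐ z ∂π, f z < ∞ := hac.ae_le (Measure.rnDeriv_lt_top _ _)
    filter_upwards [hacσ.ae_le hrn, hfpos, hftop, hk0, hac.ae_le hktop] with z h1 h2 h3 h4 h5
    rw [llr, h1, ENNReal.toReal_div, Real.log_div]
    · rfl
    · exact (ENNReal.toReal_pos h2.ne' h3.ne).ne'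
    · exact (ENNReal.toReal_pos h4 h5).ne'
  have hint2 : Integrable (fun z : α × β => llr π.snd R z.2) π :=
    hint'.comp_measurable measurable_snd
  have hintσ : Integrable (llr π (μ.prod π.snd)) π :=
    (hint.sub hint2).congr hllr.symm
  have hnn : 0 ≤ ∫ z, llr π.snd R z.2 ∂π := by
    have h := integral_llr_add_sub_measure_univ_nonneg hac' hint'
    have h2 : ∫ y, llr π.snd R y ∂π.snd = ∫ z, llr π.snd R z.2 ∂π :=
      integral_map measurable_snd.aemeasurable (measurable_llr _ _).aestronglyMeasurable
    simpa [h2] using h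
  rw [klDiv_of_ac_of_integrable hacσ hintσ, klDiv_of_ac_of_integrable hac hint]
  refine ENNReal.ofReal_le_ofReal ?_
  rw [integral_congr_ae hllr, integral_sub hint hint2]
  simp only [probReal_univ]
  linarith

/-- The divergence of two probability measures with positive densities. -/
lemma klDiv_eq_ofReal_integral_log_div {α : Type*} [MeasurableSpace α] {m π ρ : Measure α}
    [IsProbabilityMeasure π] [IsProbabilityMeasure ρ] {f g : α → ℝ}
    (hf : Measurable f) (hg : Measurable g) (hf0 : ∀ x, 0 < f x) (hg0 : ∀ x, 0 < g x)
    (hπ : π = m.withDensity fun x => ENNReal.ofReal (f x))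
    (hρ : ρ = m.withDensity fun x => ENNReal.ofReal (g x))
    (hint : Integrable (fun x => Real.log (f x / g x)) π) :
    klDiv π ρ = ENNReal.ofReal (∫ x, Real.log (f x / g x) ∂π) := by
  have hm : Measurable fun x => ENNReal.ofReal (f x / g x) := (hf.div hg).ennreal_ofReal
  have h1 : π = ρ.withDensity fun x => ENNReal.ofReal (f x / g x) := by
    rw [hρ, ← withDensity_mul _ hg.ennreal_ofReal hm, hπ]
    congr 1
    ext x
    simp only [Pi.mul_apply]
    rw [← ENNReal.ofReal_mul (hg0 x).le, mul_div_cancel₀ _ (hg0 x).ne']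
  have hac : π ≪ ρ := by
    rw [h1]
    exact withDensity_absolutelyContinuous _ _
  have hllr : llr π ρ =ᵐ[π] fun x => Real.log (f x / g x) := by
    have h2 : π.rnDeriv ρ =ᵐ[ρ] fun x => ENNReal.ofReal (f x / g x) := by
      conv_lhs => rw [h1]
      exact Measure.rnDeriv_withDensity _ hm
    filter_upwards [hac.ae_le h2] with x hx
    rw [llr, hx, ENNReal.toReal_ofReal (div_pos (hf0 x) (hg0 x)).le]
  rw [klDiv_of_ac_of_integrable hac (hint.congr hllr.symm), integral_congr_ae hllr]
  simp

lemma klDiv_map_eq_ofReal_integral {Ω α : Type*} [MeasurableSpace Ω] [MeasurableSpace α]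
    {J : Measure Ω} [IsProbabilityMeasure J] {T : Ω → α} (hT : Measurable T)
    {m ρ : Measure α} [IsProbabilityMeasure ρ] {f g : α → ℝ}
    (hf : Measurable f) (hg : Measurable g) (hf0 : ∀ x, 0 < f x) (hg0 : ∀ x, 0 < g x)
    (hπ : J.map T = m.withDensity fun x => ENNReal.ofReal (f x))
    (hρ : ρ = m.withDensity fun x => ENNReal.ofReal (g x)) {L : Ω → ℝ}
    (hL : ∀ ω, Real.log (f (T ω) / g (T ω)) = L ω) (hint : Integrable L J) :
    klDiv (J.map T) ρ = ENNReal.ofReal (∫ ω, L ω ∂J) := by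
  have := Measure.isProbabilityMeasure_map (μ := J) hT.aemeasurable
  have hm : Measurable fun x => Real.log (f x / g x) := (hf.div hg).log
  have hi : Integrable (fun x => Real.log (f x / g x)) (J.map T) := by
    rw [integrable_map_measure hm.aestronglyMeasurable hT.aemeasurable]
    exact hint.congr (Filter.Eventually.of_forall fun ω => (hL ω).symm)
  rw [klDiv_eq_ofReal_integral_log_div hf hg hf0 hg0 hπ hρ hi,
    integral_map hT.aemeasurable hm.aestronglyMeasurable]
  simp_rw [hL]

end InformationTheory

/-! ### The complex Gaussian law and finiteness of the rate. -/

namespace FadingAWGN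

lemma measurable_cscg_density :
    Measurable fun z : ℂ => ENNReal.ofReal (Real.pi⁻¹ * Real.exp (-‖z‖ ^ 2)) := by fun_prop

lemma lintegral_stdCSCG {f : ℂ → ℝ≥0∞} (hf : Measurable f) :
    ∫⁻ z, f z ∂stdCSCG = ∫⁻ z, ENNReal.ofReal (Real.pi⁻¹ * Real.exp (-‖z‖ ^ 2)) * f z := by
  rw [stdCSCG, lintegral_withDensity_eq_lintegral_mul _ measurable_cscg_density hf]
  rfl

lemma lintegral_norm_sq_stdCSCG : ∫⁻ z, ‖z‖ₑ ^ 2 ∂stdCSCG = 1 := by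
  have key := Complex.integral_rpow_mul_exp_neg_rpow (p := 2) (q := 2) (by norm_num) (by norm_num)
  have h1 : ∫ z : ℂ, ‖z‖ ^ 2 * Real.exp (-‖z‖ ^ 2) = Real.pi := by
    have h2 : Real.Gamma ((2 + 2) / 2) = 1 := by
      rw [show ((2 : ℝ) + 2) / 2 = 2 by norm_num]; exact Real.Gamma_two
    rw [h2] at key
    simp only [Real.rpow_two] at key
    rw [key]; ring
  have hint : Integrable (fun z : ℂ => ‖z‖ ^ 2 * Real.exp (-‖z‖ ^ 2)) := by
    by_contra h
    rw [integral_undef h] at h1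
    exact Real.pi_ne_zero h1.symm
  rw [lintegral_stdCSCG (by fun_prop)]
  have h3 : ∀ z : ℂ, ENNReal.ofReal (Real.pi⁻¹ * Real.exp (-‖z‖ ^ 2)) * ‖z‖ₑ ^ 2
      = ENNReal.ofReal (Real.pi⁻¹ * (‖z‖ ^ 2 * Real.exp (-‖z‖ ^ 2))) := by
    intro z
    rw [← ofReal_norm, ← ENNReal.ofReal_pow (norm_nonneg _),
      ← ENNReal.ofReal_mul (by positivity)]
    ring_nf
  simp_rw [h3]
  rw [← ofReal_integral_eq_lintegral_ofReal (hint.const_mul _)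
      (Filter.Eventually.of_forall fun z => by positivity),
    integral_const_mul, h1, inv_mul_cancel₀ Real.pi_ne_zero, ENNReal.ofReal_one]

lemma enorm_sq_eq_ofReal (z : ℂ) : ‖z‖ₑ ^ 2 = ENNReal.ofReal (‖z‖ ^ 2) := by
  rw [← ofReal_norm, ENNReal.ofReal_pow (norm_nonneg _)]

/-- The symmetry z ↦ -z and the parallelogram law remove the cross term while all integrals stay in
`ℝ≥0∞`. -/
lemma lintegral_norm_add_sq_stdCSCG (c : ℂ) :
    ∫⁻ z, ‖c + z‖ₑ ^ 2 ∂stdCSCG = ‖c‖ₑ ^ 2 + 1 := by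
  have hneg : ∫⁻ z, ‖c - z‖ₑ ^ 2 ∂stdCSCG = ∫⁻ z, ‖c + z‖ₑ ^ 2 ∂stdCSCG := by
    rw [lintegral_stdCSCG (by fun_prop), lintegral_stdCSCG (by fun_prop),
      ← lintegral_neg_eq_self]
    simp
  have hpar : ∀ z : ℂ, ‖c + z‖ₑ ^ 2 + ‖c - z‖ₑ ^ 2 = 2 * ‖c‖ₑ ^ 2 + 2 * ‖z‖ₑ ^ 2 := by
    intro z
    have h := parallelogram_law_with_norm ℝ c z
    simp only [enorm_sq_eq_ofReal]
    rw [← ENNReal.ofReal_add (by positivity) (by positivity),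
      show (2 : ℝ≥0∞) = ENNReal.ofReal 2 by simp, ← ENNReal.ofReal_mul (by norm_num),
      ← ENNReal.ofReal_mul (by norm_num), ← ENNReal.ofReal_add (by positivity) (by positivity)]
    congr 1
    nlinarith
  have hsum : 2 * ∫⁻ z, ‖c + z‖ₑ ^ 2 ∂stdCSCG = 2 * (‖c‖ₑ ^ 2 + 1) := by
    rw [two_mul]
    nth_rewrite 2 [← hneg]
    rw [← lintegral_add_left (by fun_prop)]
    simp_rw [hpar]
    rw [lintegral_add_left (by fun_prop), lintegral_const, lintegral_const_mul _ (by fun_prop),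
      lintegral_norm_sq_stdCSCG, measure_univ]
    ring
  exact (ENNReal.mul_right_inj (by simp) (by simp)).mp hsum

/-- The density of the circularly symmetric complex Gaussian law with variance `v`. -/
noncomputable def cscgPDF (v : ℝ) (y : ℂ) : ℝ := (Real.pi * v)⁻¹ * Real.exp (-(‖y‖ ^ 2 / v))

lemma cscgPDF_pos {v : ℝ} (hv : 0 < v) (y : ℂ) : 0 < cscgPDF v y := by
  unfold cscgPDF
  have := Real.pi_pos
  positivity

lemma lintegral_cscgPDF {v : ℝ} (hv : 0 < v) : ∫⁻ y : ℂ, ENNReal.ofReal (cscgPDF v y) = 1 := by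
  have key := GaussianFourier.integral_rexp_neg_mul_sq_norm (V := ℂ) (b := v⁻¹) (inv_pos.mpr hv)
  have h1 : ∫ z : ℂ, Real.exp (-(‖z‖ ^ 2 / v)) = Real.pi * v := by
    rw [Complex.finrank_real_complex] at key
    convert key using 1
    · congr 1; ext z; congr 1; field_simp
    · simp
  have hpv : Real.pi * v ≠ 0 := (mul_pos Real.pi_pos hv).ne'
  have hint : Integrable (fun z : ℂ => Real.exp (-(‖z‖ ^ 2 / v))) := by
    by_contra h
    rw [integral_undef h] at h1
    exact hpv h1.symm
  unfold cscgPDF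
  rw [← ofReal_integral_eq_lintegral_ofReal (hint.const_mul _)
      (Filter.Eventually.of_forall fun z => by have := Real.pi_pos; positivity),
    integral_const_mul, h1, inv_mul_cancel₀ hpv, ENNReal.ofReal_one]

lemma log_cscgPDF_div {v : ℝ} (hv : 0 < v) (z y : ℂ) :
    Real.log (cscgPDF 1 z / cscgPDF v y) = Real.log v - ‖z‖ ^ 2 + ‖y‖ ^ 2 / v := by
  unfold cscgPDF
  have := Real.pi_pos
  rw [Real.log_div (by positivity) (by positivity), Real.log_mul (by positivity) (by positivity),
    Real.log_mul (by positivity) (by positivity), Real.log_inv, Real.log_inv,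
    Real.log_mul (by positivity) (by positivity), Real.log_mul (by positivity) (by positivity),
    Real.log_exp, Real.log_exp, Real.log_one]
  ring

lemma log_one_add_mul_le {g x : ℝ} (hg : 0 ≤ g) (hx : 0 ≤ x) :
    Real.log (1 + g * x) ≤ g + x := by
  have h1 : 1 + g * x ≤ (1 + g) * (1 + x) := by nlinarith
  have h2 : Real.log (1 + g * x) ≤ Real.log ((1 + g) * (1 + x)) :=
    Real.log_le_log (by positivity) h1
  rw [Real.log_mul (by positivity) (by positivity)] at h2
  have h3 := Real.log_le_sub_one_of_pos (show 0 < 1 + g by positivity)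
  have h4 := Real.log_le_sub_one_of_pos (show 0 < 1 + x by positivity)
  linarith

section Rate

variable {𝓢T : Type v} {𝓢R : Type w} [MeasurableSpace 𝓢T] [MeasurableSpace 𝓢R]
  {Q : Measure (ℂ × 𝓢T × 𝓢R)} {P : ℝ≥0}

lemma policyRate_le (hH : ∫⁻ ω, ‖ω.1‖ₑ ^ 2 ∂Q = 1) {q : 𝓢T → ℝ≥0}
    (hq : q ∈ powerPolicies Q P) : policyRate Q q ≤ 1 + P := by
  have hqm : Measurable q := hq.1
  calc policyRate Q q ≤ ∫⁻ ω, ‖ω.1‖ₑ ^ 2 + (q ω.2.1 : ℝ≥0∞) ∂Q := by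
        refine lintegral_mono fun ω => ?_
        rw [enorm_sq_eq_ofReal, ← ENNReal.ofReal_coe_nnreal,
          ← ENNReal.ofReal_add (by positivity) (by positivity)]
        exact ENNReal.ofReal_le_ofReal (log_one_add_mul_le (by positivity) (by positivity))
    _ = 1 + ∫⁻ ω, (q ω.2.1 : ℝ≥0∞) ∂Q := by
        rw [lintegral_add_left (by fun_prop), hH]
    _ ≤ 1 + P := by gcongr; exact hq.2

end Rate

lemma integrable_and_integral_of_lintegral_ofReal {α : Type*} [MeasurableSpace α] {μ : Measure α}
    {f : α → ℝ} (hf : Measurable f) (h0 : ∀ x, 0 ≤ f x) {c : ℝ≥0∞}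
    (hc : ∫⁻ x, ENNReal.ofReal (f x) ∂μ = c) (hc' : c ≠ ∞) :
    Integrable f μ ∧ ∫ x, f x ∂μ = c.toReal := by
  refine ⟨⟨hf.aestronglyMeasurable, ?_⟩, ?_⟩
  · rw [hasFiniteIntegral_iff_ofReal (Filter.Eventually.of_forall h0), hc]
    exact hc'.lt_top
  · rw [integral_eq_lintegral_of_nonneg_ae (Filter.Eventually.of_forall h0)
      hf.aestronglyMeasurable, hc]

/-! ### The converse bound for a single adaptive symbol. -/

namespace AdaptiveSymbol

variable {𝓢T : Type v} {𝓢R : Type w} [MeasurableSpace 𝓢T] [MeasurableSpace 𝓢R]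
  (A : AdaptiveSymbol.{u, v} 𝓢T) (Q : Measure (ℂ × 𝓢T × 𝓢R))

lemma measurable_input_comp {α : Type*} [MeasurableSpace α] {f : α → A.Alphabet} {g : α → 𝓢T}
    (hf : Measurable f) (hg : Measurable g) : Measurable fun x => A.input (f x) (g x) :=
  A.measurable_input.comp (hf.prodMk hg)

lemma measurable_Y : Measurable (A.Y (𝓢R := 𝓢R)) := by
  have := A.measurable_input_comp (α := A.Sample 𝓢R) (f := fun ω => ω.1)
    (g := fun ω => ω.2.1.2.1) (by fun_prop) (by fun_prop)
  unfold Y X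
  fun_prop

/-- The second moment of the channel input given the CSIT. -/
noncomputable def avgPower (s : 𝓢T) : ℝ≥0∞ := ∫⁻ a, ‖A.input a s‖ₑ ^ 2 ∂A.law

lemma measurable_avgPower : Measurable A.avgPower := by
  have := A.measurable_input_comp (α := 𝓢T × A.Alphabet) measurable_snd measurable_fst
  exact Measurable.lintegral_prod_right' (f := fun x : 𝓢T × A.Alphabet => ‖A.input x.2 x.1‖ₑ ^ 2)
    (by fun_prop)

/-- The power policy induced by an adaptive symbol. -/
noncomputable def policy (s : 𝓢T) : ℝ≥0 := (A.avgPower s).toNNReal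

lemma measurable_policy : Measurable A.policy := A.measurable_avgPower.ennreal_toNNReal

variable [IsProbabilityMeasure Q]

lemma power_eq_lintegral_avgPower : A.power Q = ∫⁻ ω, A.avgPower ω.2.1 ∂Q := by
  have h1 := A.measurable_input_comp (α := A.Sample 𝓢R) (f := fun ω => ω.1)
    (g := fun ω => ω.2.1.2.1) (by fun_prop) (by fun_prop)
  have h2 := A.measurable_avgPower
  rw [power, jointLaw, lintegral_prod_symm _ (Measurable.aemeasurable (by unfold X; fun_prop))]
  change ∫⁻ x : (ℂ × 𝓢T × 𝓢R) × ℂ, A.avgPower x.1.2.1 ∂(Q.prod stdCSCG) = _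
  rw [lintegral_prod _ (by fun_prop)]
  simp

variable {Q} in
-- `policy` replaces an infinite second moment by 0; under the power constraint this happens only on
-- a null set.
lemma avgPower_ae_ne_top {P : ℝ≥0} (hA : A.power Q ≤ P) : ∀ᵐ ω ∂Q, A.avgPower ω.2.1 ≠ ∞ := by
  have h2 := A.measurable_avgPower
  rw [power_eq_lintegral_avgPower] at hA
  filter_upwards [ae_lt_top (f := fun ω : ℂ × 𝓢T × 𝓢R => A.avgPower ω.2.1) (by fun_prop)
    (ne_top_of_le_ne_top ENNReal.coe_ne_top hA)] with ω h using h.ne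

variable {Q} in
lemma policy_mem_powerPolicies {P : ℝ≥0} (hA : A.power Q ≤ P) : A.policy ∈ powerPolicies Q P := by
  refine ⟨A.measurable_policy, le_trans ?_ hA⟩
  rw [power_eq_lintegral_avgPower]
  exact lintegral_mono fun ω => ENNReal.coe_toNNReal_le_self

/-- The variance `1 + G P(S_T)` of the channel output given the channel state. -/
noncomputable def outputVariance (w : ℂ × 𝓢T × 𝓢R) : ℝ := 1 + ‖w.1‖ ^ 2 * (A.policy w.2.1 : ℝ)

lemma measurable_outputVariance : Measurable (A.outputVariance (𝓢R := 𝓢R)) := by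
  have := A.measurable_policy
  unfold outputVariance
  fun_prop

omit [MeasurableSpace 𝓢R] in
lemma one_le_outputVariance (w : ℂ × 𝓢T × 𝓢R) : 1 ≤ A.outputVariance w := by
  unfold outputVariance
  have : 0 ≤ ‖w.1‖ ^ 2 * (A.policy w.2.1 : ℝ) := by positivity
  linarith

omit [MeasurableSpace 𝓢R] in
lemma outputVariance_pos (w : ℂ × 𝓢T × 𝓢R) : 0 < A.outputVariance w :=
  one_pos.trans_le (A.one_le_outputVariance w)

/-- The joint law of the adaptive symbol, the channel state and the channel output. -/
noncomputable def fullLaw : Measure (A.Alphabet × (ℂ × 𝓢T × 𝓢R) × ℂ) :=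
  (A.jointLaw Q).map fun ω => (ω.1, ω.2.1, A.Y ω)

lemma measurable_full : Measurable fun ω : A.Sample 𝓢R => (ω.1, ω.2.1, A.Y ω) := by
  have := A.measurable_Y (𝓢R := 𝓢R)
  fun_prop

instance : IsProbabilityMeasure (A.fullLaw Q) :=
  Measure.isProbabilityMeasure_map A.measurable_full.aemeasurable

/-- Given A and the state, Y is a translate of Z, and Lebesgue measure is translation invariant. -/
lemma fullLaw_eq_withDensity : A.fullLaw Q = (A.law.prod (Q.prod volume)).withDensity fun x =>
    ENNReal.ofReal (cscgPDF 1 (x.2.2 - x.2.1.1 * A.input x.1 x.2.1.2.1)) := by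
  have h1 := A.measurable_input_comp (α := A.Sample 𝓢R) (f := fun ω => ω.1)
    (g := fun ω => ω.2.1.2.1) (by fun_prop) (by fun_prop)
  have hd : Measurable fun x : A.Sample 𝓢R =>
      ENNReal.ofReal (cscgPDF 1 (x.2.2 - x.2.1.1 * A.input x.1 x.2.1.2.1)) := by
    unfold cscgPDF; fun_prop
  have hfull := A.measurable_full (𝓢R := 𝓢R)
  refine Measure.ext_of_lintegral _ fun f hf => ?_
  rw [fullLaw, lintegral_map hf hfull, lintegral_withDensity_eq_lintegral_mul _ hd hf,
    jointLaw, lintegral_prod _ (by exact (hf.comp hfull).aemeasurable),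
    lintegral_prod _ (hd.mul hf).aemeasurable]
  refine lintegral_congr fun a => ?_
  have hma : Measurable fun y : (ℂ × 𝓢T × 𝓢R) × ℂ => f (a, y.1, A.Y (a, y)) :=
    (hf.comp hfull).comp measurable_prodMk_left
  have hmb := (hd.mul hf).comp (measurable_prodMk_left (x := a))
  rw [lintegral_prod _ hma.aemeasurable, lintegral_prod _ (by exact hmb.aemeasurable)]
  refine lintegral_congr fun w => ?_
  rw [lintegral_stdCSCG (by exact hma.comp measurable_prodMk_left)]
  symm
  rw [← lintegral_add_left_eq_self _ (w.1 * A.input a w.2.1)]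
  refine lintegral_congr fun z => ?_
  simp [cscgPDF, Y, X]

/-- The law of the channel state together with a Gaussian output of the variance given by the
channel state. -/
noncomputable def gaussianOutputLaw : Measure ((ℂ × 𝓢T × 𝓢R) × ℂ) :=
  (Q.prod volume).withDensity fun x => ENNReal.ofReal (cscgPDF (A.outputVariance x.1) x.2)

lemma measurable_gaussianOutput :
    Measurable fun x : (ℂ × 𝓢T × 𝓢R) × ℂ => cscgPDF (A.outputVariance x.1) x.2 := by
  have := A.measurable_outputVariance (𝓢R := 𝓢R)
  unfold cscgPDF
  fun_prop

instance : IsProbabilityMeasure (A.gaussianOutputLaw Q) := by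
  constructor
  rw [gaussianOutputLaw, withDensity_apply _ MeasurableSet.univ, Measure.restrict_univ,
    lintegral_prod _ A.measurable_gaussianOutput.ennreal_ofReal.aemeasurable]
  simp [lintegral_cscgPDF, outputVariance_pos]

lemma lintegral_jointLaw_state {f : ℂ × 𝓢T × 𝓢R → ℝ≥0∞} (hf : Measurable f) :
    ∫⁻ ω, f ω.2.1 ∂(A.jointLaw Q) = ∫⁻ w, f w ∂Q := by
  rw [jointLaw, lintegral_prod _ (Measurable.aemeasurable (by fun_prop))]
  dsimp only
  rw [lintegral_const, measure_univ, mul_one, lintegral_prod _ (Measurable.aemeasurable (by fun_prop))]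
  simp

lemma lintegral_noise_sq :
    ∫⁻ ω, ENNReal.ofReal (‖ω.2.2‖ ^ 2) ∂(A.jointLaw Q) = 1 := by
  simp_rw [← enorm_sq_eq_ofReal]
  rw [jointLaw, lintegral_prod _ (Measurable.aemeasurable (by fun_prop))]
  dsimp only
  rw [lintegral_const, measure_univ, mul_one, lintegral_prod _ (Measurable.aemeasurable (by fun_prop))]
  simp [lintegral_norm_sq_stdCSCG]

variable {Q} in
-- Given the state, E|Y|² = G E|X|² + 1 is the very variance of the reference output.
lemma lintegral_output_div_variance {P : ℝ≥0} (hA : A.power Q ≤ P) :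
    ∫⁻ ω, ENNReal.ofReal (‖A.Y ω‖ ^ 2 / A.outputVariance ω.2.1) ∂(A.jointLaw Q) = 1 := by
  have hY := A.measurable_Y (𝓢R := 𝓢R)
  have hv := A.measurable_outputVariance (𝓢R := 𝓢R)
  have hm : Measurable fun ω : A.Sample 𝓢R =>
      ENNReal.ofReal (‖A.Y ω‖ ^ 2 / A.outputVariance ω.2.1) := by fun_prop
  have hX := A.measurable_input_comp (α := A.Alphabet × (ℂ × 𝓢T × 𝓢R)) (f := fun ω => ω.1)
    (g := fun ω => ω.2.2.1) (by fun_prop) (by fun_prop)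
  have hinner : ∀ a (w : ℂ × 𝓢T × 𝓢R),
      ∫⁻ z, ENNReal.ofReal (‖A.Y (a, w, z)‖ ^ 2 / A.outputVariance w) ∂stdCSCG
        = (‖w.1 * A.input a w.2.1‖ₑ ^ 2 + 1) * (ENNReal.ofReal (A.outputVariance w))⁻¹ := by
    intro a w
    simp_rw [ENNReal.ofReal_div_of_pos (A.outputVariance_pos w), ← enorm_sq_eq_ofReal,
      div_eq_mul_inv]
    have hmY : Measurable fun z => A.Y (a, w, z) := hY.comp (by fun_prop)
    rw [lintegral_mul_const _ (by fun_prop)]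
    congr 1
    exact lintegral_norm_add_sq_stdCSCG (w.1 * A.input a w.2.1)
  rw [jointLaw, lintegral_prod _ hm.aemeasurable]
  have hstep : ∀ a, ∫⁻ y : (ℂ × 𝓢T × 𝓢R) × ℂ,
      ENNReal.ofReal (‖A.Y (a, y)‖ ^ 2 / A.outputVariance y.1) ∂(Q.prod stdCSCG)
        = ∫⁻ w, (‖w.1 * A.input a w.2.1‖ₑ ^ 2 + 1) *
            (ENNReal.ofReal (A.outputVariance w))⁻¹ ∂Q := by
    intro a
    rw [lintegral_prod _ (by exact (hm.comp measurable_prodMk_left).aemeasurable)]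
    exact lintegral_congr fun w => hinner a w
  simp_rw [hstep]
  -- Tonelli: the symbol has to be averaged at a fixed state for the power p(S_T) to appear.
  rw [lintegral_lintegral_swap (by
    refine Measurable.aemeasurable ?_
    change Measurable fun x : A.Alphabet × (ℂ × 𝓢T × 𝓢R) =>
      (‖x.2.1 * A.input x.1 x.2.2.1‖ₑ ^ 2 + 1) * (ENNReal.ofReal (A.outputVariance x.2))⁻¹
    fun_prop)]
  have hone : ∀ᵐ w ∂Q, ∫⁻ a, (‖w.1 * A.input a w.2.1‖ₑ ^ 2 + 1) *
      (ENNReal.ofReal (A.outputVariance w))⁻¹ ∂A.law = 1 := by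
    filter_upwards [A.avgPower_ae_ne_top hA] with w hw
    have hXw := A.measurable_input_comp (f := fun a => a) (g := fun _ => w.2.1) (by fun_prop)
      (by fun_prop)
    have hvw : ENNReal.ofReal (A.outputVariance w) = ‖w.1‖ₑ ^ 2 * A.avgPower w.2.1 + 1 := by
      rw [outputVariance, ENNReal.ofReal_add (by positivity) (by positivity),
        ENNReal.ofReal_mul (by positivity), ← enorm_sq_eq_ofReal, ENNReal.ofReal_coe_nnreal,
        policy, ENNReal.coe_toNNReal hw, ENNReal.ofReal_one, add_comm]
    rw [lintegral_mul_const _ (by fun_prop), lintegral_add_right _ (by fun_prop)]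
    simp_rw [enorm_mul, mul_pow]
    rw [lintegral_const_mul _ (by fun_prop), lintegral_const, measure_univ, mul_one]
    change (‖w.1‖ₑ ^ 2 * A.avgPower w.2.1 + 1) * _ = 1
    rw [← hvw]
    exact ENNReal.mul_inv_cancel (by simpa using A.outputVariance_pos w) ENNReal.ofReal_ne_top
  rw [lintegral_congr_ae hone]
  simp

variable {Q} in
lemma klDiv_fullLaw (hH : ∫⁻ ω, ‖ω.1‖ₑ ^ 2 ∂Q = 1) {P : ℝ≥0} (hA : A.power Q ≤ P) :
    klDiv (A.fullLaw Q) (A.law.prod (A.gaussianOutputLaw Q)) = policyRate Q A.policy := by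
  have h1 := A.measurable_input_comp (α := A.Sample 𝓢R) (f := fun ω => ω.1)
    (g := fun ω => ω.2.1.2.1) (by fun_prop) (by fun_prop)
  have hv := A.measurable_outputVariance (𝓢R := 𝓢R)
  have hY := A.measurable_Y (𝓢R := 𝓢R)
  have hfull := A.measurable_full (𝓢R := 𝓢R)
  have hd : Measurable fun x : A.Sample 𝓢R =>
      cscgPDF 1 (x.2.2 - x.2.1.1 * A.input x.1 x.2.1.2.1) := by
    unfold cscgPDF; fun_prop
  have hg : Measurable fun x : A.Sample 𝓢R => cscgPDF (A.outputVariance x.2.1) x.2.2 :=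
    A.measurable_gaussianOutput.comp measurable_snd
  have hrate : policyRate Q A.policy ≠ ∞ :=
    ne_top_of_le_ne_top (by simp) (policyRate_le hH (A.policy_mem_powerPolicies hA))
  obtain ⟨i1, e1⟩ := integrable_and_integral_of_lintegral_ofReal (μ := A.jointLaw Q)
    (f := fun ω => Real.log (A.outputVariance ω.2.1)) (by fun_prop)
    (fun ω => Real.log_nonneg (A.one_le_outputVariance _)) (c := policyRate Q A.policy)
    (A.lintegral_jointLaw_state Q (f := fun w => ENNReal.ofReal (Real.log (A.outputVariance w)))
      (by fun_prop)) hrate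
  obtain ⟨i2, e2⟩ := integrable_and_integral_of_lintegral_ofReal (μ := A.jointLaw Q)
    (f := fun ω => ‖ω.2.2‖ ^ 2) (by fun_prop) (fun ω => by positivity) (c := 1)
    (A.lintegral_noise_sq Q) (by simp)
  obtain ⟨i3, e3⟩ := integrable_and_integral_of_lintegral_ofReal (μ := A.jointLaw Q)
    (f := fun ω => ‖A.Y ω‖ ^ 2 / A.outputVariance ω.2.1) (by fun_prop)
    (fun ω => div_nonneg (by positivity) (A.outputVariance_pos _).le) (c := 1)
    (A.lintegral_output_div_variance hA) (by simp)
  have hlog : ∀ ω : A.Sample 𝓢R,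
      Real.log (cscgPDF 1 (A.Y ω - ω.2.1.1 * A.input ω.1 ω.2.1.2.1) /
        cscgPDF (A.outputVariance ω.2.1) (A.Y ω))
        = Real.log (A.outputVariance ω.2.1) - ‖ω.2.2‖ ^ 2
          + ‖A.Y ω‖ ^ 2 / A.outputVariance ω.2.1 := by
    intro ω
    rw [log_cscgPDF_div (A.outputVariance_pos _)]
    simp [Y, X]
  have hkl := klDiv_map_eq_ofReal_integral (m := A.law.prod (Q.prod volume)) (J := A.jointLaw Q)
    (ρ := A.law.prod (A.gaussianOutputLaw Q)) hfull hd hg (fun x => cscgPDF_pos one_pos _) (fun x => cscgPDF_pos (A.outputVariance_pos _) _)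
    (A.fullLaw_eq_withDensity Q)
    (prod_withDensity_right A.measurable_gaussianOutput.ennreal_ofReal) hlog
    (by exact (i1.sub i2).add i3)
  rw [integral_add (by exact i1.sub i2) i3, integral_sub i1 i2, e1, e2, e3] at hkl
  rw [fullLaw, hkl]
  simp [hrate]

/-- A is independent of S_R, so its law splits off, and the law of S_R recombines with the
conditional law of Y into their joint law. -/
lemma compProd_condDistrib_eq_map :
    ((A.jointLaw Q).map fun ω => (A.symbol ω, A.csir ω)) ⊗ₘ
        (Kernel.prodMkLeft A.Alphabet (condDistrib A.Y A.csir (A.jointLaw Q)))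
      = (A.law.prod (A.fullLaw Q).snd).map fun x => ((x.1, x.2.1.2.2), x.2.2) := by
  have hY := A.measurable_Y (𝓢R := 𝓢R)
  have hS : Measurable (A.csir (𝓢R := 𝓢R)) := by unfold csir; fun_prop
  have hk : Measurable fun y : (ℂ × 𝓢T × 𝓢R) × ℂ => y.1.2.2 := by fun_prop
  have hcsir : (A.jointLaw Q).map A.csir = (Q.prod stdCSCG).map fun y => y.1.2.2 := by
    have h := Measure.map_map (μ := A.jointLaw Q) hk measurable_snd
    rw [Measure.map_snd_prod, measure_univ, one_smul] at h
    exact h.symm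
  have hpair : ((A.jointLaw Q).map fun ω => (A.symbol ω, A.csir ω))
      = A.law.prod ((A.jointLaw Q).map A.csir) := by
    rw [hcsir]
    have h := Measure.map_prod_map A.law (Q.prod stdCSCG) measurable_id hk
    rw [Measure.map_id] at h
    exact h.symm
  have hfst : IsProbabilityMeasure ((A.jointLaw Q).map A.csir) :=
    Measure.isProbabilityMeasure_map hS.aemeasurable
  have hfull := A.measurable_full (𝓢R := 𝓢R)
  have hg : Measurable fun x : A.Alphabet × (ℂ × 𝓢T × 𝓢R) × ℂ =>
      ((x.1, x.2.1.2.2), x.2.2) := by fun_prop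
  rw [hpair]
  refine Measure.ext_of_lintegral _ fun f hf => ?_
  rw [Measure.lintegral_compProd hf, lintegral_map hf hg, lintegral_prod _ (by
    exact (hf.lintegral_kernel_prod_right').aemeasurable),
    lintegral_prod _ (by exact (hf.comp hg).aemeasurable)]
  refine lintegral_congr fun a => ?_
  have hfa : Measurable fun y : 𝓢R × ℂ => f ((a, y.1), y.2) := hf.comp (by fun_prop)
  have hl := Measure.lintegral_compProd (μ := (A.jointLaw Q).map A.csir)
    (κ := condDistrib A.Y A.csir (A.jointLaw Q)) hfa
  rw [compProd_map_condDistrib hY.aemeasurable, lintegral_map hfa (hS.prodMk hY)] at hl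
  simp only [Kernel.prodMkLeft_apply]
  rw [← hl, Measure.snd, lintegral_map (by exact (hf.comp hg).comp measurable_prodMk_left)
    measurable_snd, fullLaw, lintegral_map (by
      exact ((hf.comp hg).comp measurable_prodMk_left).comp measurable_snd) hfull]
  rfl

variable {Q} in
lemma condMutualInfo_le_policyRate (hH : ∫⁻ ω, ‖ω.1‖ₑ ^ 2 ∂Q = 1) {P : ℝ≥0}
    (hA : A.power Q ≤ P) :
    condMutualInfo (A.jointLaw Q) A.symbol A.Y A.csir ≤ policyRate Q A.policy := by
  have hg : Measurable fun x : A.Alphabet × (ℂ × 𝓢T × 𝓢R) × ℂ =>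
      ((x.1, x.2.1.2.2), x.2.2) := by fun_prop
  rw [condMutualInfo, compProd_condDistrib_eq_map, ← A.klDiv_fullLaw hH hA]
  have hmap : ((A.jointLaw Q).map fun ω => ((A.symbol ω, A.csir ω), A.Y ω))
      = (A.fullLaw Q).map fun x => ((x.1, x.2.1.2.2), x.2.2) := by
    rw [fullLaw, Measure.map_map hg A.measurable_full]
    rfl
  rw [hmap]
  exact (klDiv_map_le _ _ hg).trans (klDiv_prod_snd_le _ _ _)

end AdaptiveSymbol

/-! ### Existence of an optimal power policy. -/

open Filter Topology

/-- The arithmetic mean is √(ab) · cosh((log a - log b)/2), which gives the concavity deficit of log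
exactly. -/
lemma log_half_add_eq {a b : ℝ} (ha : 0 < a) (hb : 0 < b) :
    Real.log ((a + b) / 2) = (Real.log a + Real.log b) / 2
      + Real.log (Real.cosh ((Real.log a - Real.log b) / 2)) := by
  rw [← Real.log_exp ((Real.log a + Real.log b) / 2),
    ← Real.log_mul (Real.exp_pos _).ne' (Real.cosh_pos _).ne']
  congr 1
  rw [Real.cosh_eq, mul_div_assoc', mul_add, ← Real.exp_add, ← Real.exp_add]
  ring_nf
  rw [Real.exp_log ha, Real.exp_log hb]

lemma log_one_add_mul_sq_le {g x : ℝ} (hg : 0 ≤ g) (hx : 0 ≤ x) :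
    Real.log (1 + g * x) ^ 2 ≤ 16 * (1 + g + x) := by
  have h0 : 0 ≤ Real.log (1 + g * x) := Real.log_nonneg (by nlinarith [mul_nonneg hg hx])
  have hy : 0 < 1 + g + x := by positivity
  have h1 : Real.log (1 + g * x) ≤ 4 * √(1 + g + x) := by
    -- With y = 1 + g + x, 1 + gx ≤ y² = (√y)⁴, and log √y ≤ √y - 1.
    have h2 : Real.log (1 + g * x) ≤ Real.log ((√(1 + g + x)) ^ 4) := by
      refine Real.log_le_log (by positivity) ?_
      rw [show (√(1 + g + x)) ^ 4 = ((√(1 + g + x)) ^ 2) ^ 2 by ring, Real.sq_sqrt hy.le]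
      nlinarith [mul_nonneg hg hx, sq_nonneg g, sq_nonneg x]
    rw [Real.log_pow] at h2
    have h3 := Real.log_le_sub_one_of_pos (Real.sqrt_pos.mpr hy)
    push_cast at h2
    linarith
  calc Real.log (1 + g * x) ^ 2 ≤ (4 * √(1 + g + x)) ^ 2 := by gcongr
    _ = 16 * (1 + g + x) := by rw [mul_pow, Real.sq_sqrt hy.le]; norm_num

variable {𝓢T : Type v} {𝓢R : Type w}

/-- The rate `log (1 + G P(S_T))` as a random variable. -/
noncomputable def logRate (p : 𝓢T → ℝ≥0) (ω : ℂ × 𝓢T × 𝓢R) : ℝ :=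
  Real.log (1 + ‖ω.1‖ ^ 2 * (p ω.2.1 : ℝ))

lemma logRate_nonneg (p : 𝓢T → ℝ≥0) (ω : ℂ × 𝓢T × 𝓢R) : 0 ≤ logRate p ω := by
  refine Real.log_nonneg ?_
  have : 0 ≤ ‖ω.1‖ ^ 2 * (p ω.2.1 : ℝ) := by positivity
  linarith

variable [MeasurableSpace 𝓢T] [MeasurableSpace 𝓢R]

lemma measurable_logRate {p : 𝓢T → ℝ≥0} (hp : Measurable p) :
    Measurable (logRate p : ℂ × 𝓢T × 𝓢R → ℝ) := by
  unfold logRate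
  fun_prop

variable {Q : Measure (ℂ × 𝓢T × 𝓢R)} {P : ℝ≥0}

lemma midpoint_mem_powerPolicies {p q : 𝓢T → ℝ≥0} (hp : p ∈ powerPolicies Q P)
    (hq : q ∈ powerPolicies Q P) : (fun s => (p s + q s) / 2) ∈ powerPolicies Q P := by
  have hpm : Measurable p := hp.1
  have hqm : Measurable q := hq.1
  refine ⟨by fun_prop, ?_⟩
  have h : ∀ ω : ℂ × 𝓢T × 𝓢R, (((p ω.2.1 + q ω.2.1) / 2 : ℝ≥0) : ℝ≥0∞)
      = ((p ω.2.1 : ℝ≥0∞) + q ω.2.1) * 2⁻¹ := by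
    intro ω
    rw [ENNReal.coe_div two_ne_zero, ENNReal.coe_add, div_eq_mul_inv]
    rfl
  simp_rw [h]
  rw [lintegral_mul_const _ (by fun_prop), lintegral_add_left (by fun_prop)]
  calc _ ≤ ((P : ℝ≥0∞) + P) * 2⁻¹ := by gcongr; exacts [hp.2, hq.2]
    _ = P := by rw [← two_mul, mul_comm, ← mul_assoc, ENNReal.inv_mul_cancel] <;> simp

/-- Strong concavity of the rate as a function of the power policy. -/
lemma policyRate_midpoint {p q : 𝓢T → ℝ≥0} (hp : Measurable p) (hq : Measurable q) :
    2 * policyRate Q (fun s => (p s + q s) / 2) = policyRate Q p + policyRate Q q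
      + 2 * ∫⁻ ω, ENNReal.ofReal (Real.log (Real.cosh ((logRate p ω - logRate q ω) / 2))) ∂Q := by
  have h1 := measurable_logRate (𝓢R := 𝓢R) hp
  have h2 := measurable_logRate (𝓢R := 𝓢R) hq
  have hc : Measurable fun ω : ℂ × 𝓢T × 𝓢R =>
      Real.log (Real.cosh ((logRate p ω - logRate q ω) / 2)) :=
    Real.measurable_log.comp
      (Real.continuous_cosh.measurable.comp ((h1.sub h2).div_const 2))
  change 2 * ∫⁻ ω, ENNReal.ofReal (logRate (fun s => (p s + q s) / 2) ω) ∂Q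
    = ∫⁻ ω, ENNReal.ofReal (logRate p ω) ∂Q + ∫⁻ ω, ENNReal.ofReal (logRate q ω) ∂Q + _
  have hm : Measurable fun s => (p s + q s) / 2 := by fun_prop
  rw [← lintegral_const_mul _ (measurable_logRate hm).ennreal_ofReal,
    ← lintegral_const_mul _ hc.ennreal_ofReal, ← lintegral_add_left h1.ennreal_ofReal,
    ← lintegral_add_left (by fun_prop)]
  refine lintegral_congr fun ω => ?_
  have hlc : 0 ≤ Real.log (Real.cosh ((logRate p ω - logRate q ω) / 2)) :=
    Real.log_nonneg (Real.one_le_cosh _)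
  rw [← ENNReal.ofReal_add (logRate_nonneg _ _) (logRate_nonneg _ _),
    show (2 : ℝ≥0∞) = ENNReal.ofReal 2 by simp, ← ENNReal.ofReal_mul (by norm_num),
    ← ENNReal.ofReal_mul (by norm_num), ← ENNReal.ofReal_add
      (add_nonneg (logRate_nonneg _ _) (logRate_nonneg _ _)) (by positivity)]
  congr 1
  have h := log_half_add_eq (a := 1 + ‖ω.1‖ ^ 2 * (p ω.2.1 : ℝ))
    (b := 1 + ‖ω.1‖ ^ 2 * (q ω.2.1 : ℝ)) (by positivity) (by positivity)
  have h3 : logRate (fun s => (p s + q s) / 2) ω = Real.log ((1 + ‖ω.1‖ ^ 2 * (p ω.2.1 : ℝ)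
      + (1 + ‖ω.1‖ ^ 2 * (q ω.2.1 : ℝ))) / 2) := by
    unfold logRate
    congr 1
    push_cast
    ring
  rw [h3, h]
  unfold logRate
  ring

/-- The midpoint is feasible, so its rate is at most M; twice the deficit is then at most 2δ once
the finite rates are cancelled. -/
lemma lintegral_log_cosh_le {M δ : ℝ≥0∞} (hM : M ≠ ∞)
    (hle : ∀ q ∈ powerPolicies Q P, policyRate Q q ≤ M) {p q : 𝓢T → ℝ≥0}
    (hp : p ∈ powerPolicies Q P) (hq : q ∈ powerPolicies Q P)
    (hpM : M ≤ policyRate Q p + δ) (hqM : M ≤ policyRate Q q + δ) :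
    ∫⁻ ω, ENNReal.ofReal (Real.log (Real.cosh ((logRate p ω - logRate q ω) / 2))) ∂Q ≤ δ := by
  set I := ∫⁻ ω, ENNReal.ofReal (Real.log (Real.cosh ((logRate p ω - logRate q ω) / 2))) ∂Q
  have hmid := policyRate_midpoint (Q := Q) hp.1 hq.1
  have h1 : policyRate Q p + policyRate Q q + 2 * I ≤ 2 * M := by
    rw [← hmid]
    gcongr
    exact hle _ (midpoint_mem_powerPolicies hp hq)
  have hp' : policyRate Q p ≠ ∞ := ne_top_of_le_ne_top hM (hle p hp)
  have hq' : policyRate Q q ≠ ∞ := ne_top_of_le_ne_top hM (hle q hq)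
  have h2 : policyRate Q p + policyRate Q q + 2 * I
      ≤ policyRate Q p + policyRate Q q + 2 * δ := by
    calc _ ≤ M + M := by rw [← two_mul]; exact h1
      _ ≤ (policyRate Q p + δ) + (policyRate Q q + δ) := add_le_add hpM hqM
      _ = _ := by ring
  have h3 : 2 * I ≤ 2 * δ :=
    (ENNReal.add_le_add_iff_left (ENNReal.add_ne_top.mpr ⟨hp', hq'⟩)).mp h2
  exact (ENNReal.mul_le_mul_iff_right (by simp) (by simp)).mp h3

/-- Markov's inequality, as log cosh is even and increasing in the absolute value. -/
lemma meas_le_abs_sub_logRate_le {p q : 𝓢T → ℝ≥0} {r ε : ℝ} (hε : 0 < ε)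
    (hp : Measurable p) (hq : Measurable q)
    (h : ∫⁻ ω, ENNReal.ofReal (Real.log (Real.cosh ((logRate p ω - logRate q ω) / 2))) ∂Q
      ≤ ENNReal.ofReal (r * Real.log (Real.cosh (ε / 2)))) :
    Q {ω | ε ≤ |logRate p ω - logRate q ω|} ≤ ENNReal.ofReal r := by
  have h1 := measurable_logRate (𝓢R := 𝓢R) hp
  have h2 := measurable_logRate (𝓢R := 𝓢R) hq
  have hc : Measurable fun ω : ℂ × 𝓢T × 𝓢R =>
      Real.log (Real.cosh ((logRate p ω - logRate q ω) / 2)) :=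
    Real.measurable_log.comp
      (Real.continuous_cosh.measurable.comp ((h1.sub h2).div_const 2))
  have hpos : 0 < Real.log (Real.cosh (ε / 2)) :=
    Real.log_pos (Real.one_lt_cosh.mpr (by positivity))
  set L := Real.log (Real.cosh (ε / 2)) with hL
  have hsub : {ω : ℂ × 𝓢T × 𝓢R | ε ≤ |logRate p ω - logRate q ω|} ⊆
      {ω | ENNReal.ofReal L
        ≤ ENNReal.ofReal (Real.log (Real.cosh ((logRate p ω - logRate q ω) / 2)))} := by
    intro ω hω
    refine ENNReal.ofReal_le_ofReal (Real.log_le_log (Real.cosh_pos _) ?_)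
    rw [Real.cosh_le_cosh, abs_div, abs_div, abs_of_pos hε]
    gcongr
    exact hω
  have hmarkov := mul_meas_ge_le_lintegral (μ := Q) hc.ennreal_ofReal (ENNReal.ofReal L)
  have h3 : ENNReal.ofReal L * Q {ω | ε ≤ |logRate p ω - logRate q ω|}
      ≤ ENNReal.ofReal L * ENNReal.ofReal r := by
    calc _ ≤ _ := mul_le_mul_right (measure_mono hsub) _
      _ ≤ _ := hmarkov
      _ ≤ _ := h
      _ = _ := by rw [mul_comm r, ENNReal.ofReal_mul hpos.le]
  exact (ENNReal.mul_le_mul_iff_right (by simpa using hpos) (by simp)).mp h3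

/-- By Borel-Cantelli, almost surely all but finitely many steps are below 2⁻ᵏ, so the sequence is
Cauchy. -/
lemma ae_tendsto_of_summable_steps {p : ℕ → 𝓢T → ℝ≥0}
    (h : ∀ k, Q {ω | (1 / 2 : ℝ) ^ k ≤ |logRate (p k) ω - logRate (p (k + 1)) ω|}
      ≤ ENNReal.ofReal ((1 / 2) ^ k)) :
    ∀ᵐ ω ∂Q, ∃ l, Tendsto (fun k => logRate (p k) ω) atTop (𝓝 l) := by
  have hsum : ∑' k, Q {ω | (1 / 2 : ℝ) ^ k ≤ |logRate (p k) ω - logRate (p (k + 1)) ω|} ≠ ∞ := by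
    refine ne_top_of_le_ne_top ?_ (ENNReal.tsum_le_tsum h)
    rw [← ENNReal.ofReal_tsum_of_nonneg (fun _ => by positivity) summable_geometric_two]
    exact ENNReal.ofReal_ne_top
  filter_upwards [ae_eventually_notMem hsum] with ω hω
  refine cauchySeq_tendsto_of_complete (cauchySeq_of_summable_dist ?_)
  refine Summable.of_norm_bounded_eventually_nat summable_geometric_two ?_
  filter_upwards [hω] with k hk
  simp only [not_le] at hk
  rw [Real.norm_of_nonneg dist_nonneg, Real.dist_eq]
  exact hk.le

/-- The pointwise lower limit of a sequence of power policies. -/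
noncomputable def limPolicy (p : ℕ → 𝓢T → ℝ≥0) (s : 𝓢T) : ℝ≥0 :=
  (liminf (fun k => (p k s : ℝ≥0∞)) atTop).toNNReal

lemma limPolicy_mem_powerPolicies {p : ℕ → 𝓢T → ℝ≥0} (hp : ∀ k, p k ∈ powerPolicies Q P) :
    limPolicy p ∈ powerPolicies Q P := by
  have hm : ∀ k, Measurable fun s => (p k s : ℝ≥0∞) := fun k => (hp k).1.coe_nnreal_ennreal
  refine ⟨(Measurable.liminf hm).ennreal_toNNReal, ?_⟩
  calc _ ≤ ∫⁻ ω, liminf (fun k => (p k ω.2.1 : ℝ≥0∞)) atTop ∂Q :=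
        lintegral_mono fun ω => ENNReal.coe_toNNReal_le_self
    _ ≤ liminf (fun k => ∫⁻ ω, (p k ω.2.1 : ℝ≥0∞) ∂Q) atTop :=
        lintegral_liminf_le fun k => (hm k).comp (by fun_prop)
    _ ≤ P := by
        refine (liminf_le_liminf (Eventually.of_forall fun k => (hp k).2)).trans ?_
        simp

omit [MeasurableSpace 𝓢T] [MeasurableSpace 𝓢R] in
-- Where H = 0 the policies need not converge, but every rate vanishes; elsewhere the power is a
-- continuous function of the rate, so the lower limit is a limit.
lemma tendsto_logRate_limPolicy {p : ℕ → 𝓢T → ℝ≥0} {ω : ℂ × 𝓢T × 𝓢R} {l : ℝ}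
    (h : Tendsto (fun k => logRate (p k) ω) atTop (𝓝 l)) :
    Tendsto (fun k => logRate (p k) ω) atTop (𝓝 (logRate (limPolicy p) ω)) := by
  by_cases h0 : ω.1 = 0
  · simp [logRate, h0]
  have hg : 0 < ‖ω.1‖ ^ 2 := by positivity
  have hp : ∀ k, (p k ω.2.1 : ℝ) = (Real.exp (logRate (p k) ω) - 1) / ‖ω.1‖ ^ 2 := by
    intro k
    rw [logRate, Real.exp_log (by positivity)]
    field_simp
    ring
  have hlim : Tendsto (fun k => (p k ω.2.1 : ℝ)) atTop (𝓝 ((Real.exp l - 1) / ‖ω.1‖ ^ 2)) := by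
    simp_rw [hp]
    exact ((Real.continuous_exp.tendsto l).comp h |>.sub_const 1).div_const _
  have hc0 : 0 ≤ (Real.exp l - 1) / ‖ω.1‖ ^ 2 := ge_of_tendsto' hlim fun k => NNReal.coe_nonneg _
  lift (Real.exp l - 1) / ‖ω.1‖ ^ 2 to ℝ≥0 using hc0 with c hc
  have hlim' : Tendsto (fun k => p k ω.2.1) atTop (𝓝 c) := NNReal.tendsto_coe.mp hlim
  have hval : limPolicy p ω.2.1 = c := by
    rw [limPolicy, (ENNReal.tendsto_coe.mpr hlim').liminf_eq, ENNReal.toNNReal_coe]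
  unfold logRate
  rw [hval]
  exact ((hlim.const_mul _).const_add 1).log (by positivity)

/-- Where the log-rate L exceeds K, L ≤ L²/K, and L² is bounded linearly in G and the power; the
truncation error is uniform over feasible policies. -/
lemma policyRate_le_truncated (hH : ∫⁻ ω, ‖ω.1‖ₑ ^ 2 ∂Q = 1) [IsProbabilityMeasure Q]
    {q : 𝓢T → ℝ≥0} (hq : q ∈ powerPolicies Q P) {K : ℝ} (hK : 0 < K) :
    policyRate Q q ≤ ∫⁻ ω, ENNReal.ofReal (min (logRate q ω) K) ∂Q
      + ENNReal.ofReal (16 / K) * (2 + P) := by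
  have hqm : Measurable q := hq.1
  have h1 := measurable_logRate (𝓢R := 𝓢R) hqm
  have hpt : ∀ ω : ℂ × 𝓢T × 𝓢R, ENNReal.ofReal (logRate q ω)
      ≤ ENNReal.ofReal (min (logRate q ω) K)
        + ENNReal.ofReal (16 / K) * (1 + ‖ω.1‖ₑ ^ 2 + (q ω.2.1 : ℝ≥0∞)) := by
    intro ω
    have hsq := log_one_add_mul_sq_le (g := ‖ω.1‖ ^ 2) (x := q ω.2.1) (by positivity)
      (by positivity)
    change logRate q ω ^ 2 ≤ _ at hsq
    have h0 := logRate_nonneg q ω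
    rw [enorm_sq_eq_ofReal, ← ENNReal.ofReal_coe_nnreal, ← ENNReal.ofReal_one,
      ← ENNReal.ofReal_add (by positivity) (by positivity),
      ← ENNReal.ofReal_add (by positivity) (by positivity),
      ← ENNReal.ofReal_mul (by positivity),
      ← ENNReal.ofReal_add (by positivity) (by positivity)]
    refine ENNReal.ofReal_le_ofReal ?_
    rcases le_total (logRate q ω) K with hle | hle
    · rw [min_eq_left hle]
      have : 0 ≤ 16 / K * (1 + ‖ω.1‖ ^ 2 + (q ω.2.1 : ℝ)) := by positivity
      linarith
    · rw [min_eq_right hle]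
      have h2 : logRate q ω ≤ 16 / K * (1 + ‖ω.1‖ ^ 2 + (q ω.2.1 : ℝ)) := by
        rw [div_mul_eq_mul_div, le_div_iff₀ hK]
        nlinarith
      linarith
  calc policyRate Q q ≤ ∫⁻ ω, (ENNReal.ofReal (min (logRate q ω) K)
        + ENNReal.ofReal (16 / K) * (1 + ‖ω.1‖ₑ ^ 2 + (q ω.2.1 : ℝ≥0∞))) ∂Q := lintegral_mono hpt
    _ = ∫⁻ ω, ENNReal.ofReal (min (logRate q ω) K) ∂Q
        + ENNReal.ofReal (16 / K) * (1 + 1 + ∫⁻ ω, (q ω.2.1 : ℝ≥0∞) ∂Q) := by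
      rw [lintegral_add_left (by fun_prop), lintegral_const_mul _ (by fun_prop),
        lintegral_add_left (by fun_prop), lintegral_add_left (by fun_prop), hH]
      simp
    _ ≤ _ := by
      rw [one_add_one_eq_two]
      gcongr
      exact hq.2

/-- An upper limit of rates is achieved along an almost surely convergent sequence of rates. -/
lemma le_policyRate_limPolicy [IsProbabilityMeasure Q] (hH : ∫⁻ ω, ‖ω.1‖ₑ ^ 2 ∂Q = 1)
    {p : ℕ → 𝓢T → ℝ≥0} (hp : ∀ k, p k ∈ powerPolicies Q P)
    (hlim : ∀ᵐ ω ∂Q, ∃ l, Tendsto (fun k => logRate (p k) ω) atTop (𝓝 l))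
    {M : ℝ≥0∞} {δ : ℕ → ℝ≥0∞} (hδ : Tendsto δ atTop (𝓝 0))
    (hM : ∀ k, M ≤ policyRate Q (p k) + δ k) : M ≤ policyRate Q (limPolicy p) := by
  -- Fatou would bound the limiting rate from the wrong side; truncating at n + 1 permits dominated
  -- convergence.
  have htrunc : ∀ n : ℕ, M ≤ policyRate Q (limPolicy p)
      + ENNReal.ofReal (16 / (n + 1 : ℝ)) * (2 + P) := by
    intro n
    have hK : (0 : ℝ) < n + 1 := by positivity
    have hconv : Tendsto (fun k => ∫⁻ ω, ENNReal.ofReal (min (logRate (p k) ω) (n + 1)) ∂Q) atTop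
        (𝓝 (∫⁻ ω, ENNReal.ofReal (min (logRate (limPolicy p) ω) (n + 1)) ∂Q)) := by
      refine tendsto_lintegral_of_dominated_convergence (fun _ => ENNReal.ofReal (n + 1))
        (fun k => ?_) (fun k => Eventually.of_forall fun ω => ?_) (by simp) ?_
      · have := measurable_logRate (𝓢R := 𝓢R) (hp k).1
        fun_prop
      · exact ENNReal.ofReal_le_ofReal (min_le_right _ _)
      · filter_upwards [hlim] with ω hω
        obtain ⟨l, hl⟩ := hω
        exact ENNReal.tendsto_ofReal ((tendsto_logRate_limPolicy hl).min tendsto_const_nhds)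
    have hall := ge_of_tendsto' ((hconv.add_const
      (ENNReal.ofReal (16 / (n + 1 : ℝ)) * (2 + P))).add hδ) fun k => (hM k).trans
        (add_le_add_left (policyRate_le_truncated hH (hp k) hK) (δ k))
    rw [add_zero] at hall
    refine hall.trans (add_le_add_left (lintegral_mono fun ω => ?_) _)
    exact ENNReal.ofReal_le_ofReal (min_le_left _ _)
  have h16 : Tendsto (fun n : ℕ => ENNReal.ofReal (16 / (n + 1 : ℝ))) atTop (𝓝 0) := by
    have h := ENNReal.tendsto_ofReal
      ((tendsto_one_div_add_atTop_nhds_zero_nat (𝕜 := ℝ)).const_mul 16)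
    simpa [div_eq_mul_inv] using h
  have h := (ENNReal.Tendsto.mul_const h16 (b := 2 + (P : ℝ≥0∞))
    (Or.inr (by simp))).const_add (policyRate Q (limPolicy p))
  rw [zero_mul, add_zero] at h
  exact ge_of_tendsto' h htrunc

/-- The rate has a maximizer among the power policies. -/
theorem exists_isMax_policyRate [IsProbabilityMeasure Q] (hH : ∫⁻ ω, ‖ω.1‖ₑ ^ 2 ∂Q = 1)
    (P : ℝ≥0) : ∃ p ∈ powerPolicies Q P, ∀ q ∈ powerPolicies Q P,
      policyRate Q q ≤ policyRate Q p := by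
  set M : ℝ≥0∞ := ⨆ q ∈ powerPolicies Q P, policyRate Q q with hMdef
  have hle : ∀ q ∈ powerPolicies Q P, policyRate Q q ≤ M := fun q hq =>
    le_iSup₂ (f := fun q (_ : q ∈ powerPolicies Q P) => policyRate Q q) q hq
  have hM : M ≠ ∞ := ne_top_of_le_ne_top (b := 1 + (P : ℝ≥0∞)) (by simp)
    (iSup₂_le fun q hq => policyRate_le hH hq)
  have happrox : ∀ δ : ℝ≥0∞, δ ≠ 0 → ∃ p ∈ powerPolicies Q P, M ≤ policyRate Q p + δ := by
    intro δ hδ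
    rcases eq_or_ne M 0 with h0 | h0
    · exact ⟨fun _ => 0, ⟨measurable_const, by simp⟩, by simp [h0]⟩
    · obtain ⟨q, hq, hlt⟩ := lt_biSup_iff.mp (ENNReal.sub_lt_self hM h0 hδ)
      exact ⟨q, hq, tsub_le_iff_right.mp hlt.le⟩
  -- With tolerance φ(2⁻ᵏ), Markov's inequality gives probability at most 2⁻ᵏ to a step of size at
  -- least 2⁻ᵏ.
  set φ : ℝ → ℝ := fun x => x * Real.log (Real.cosh (x / 2)) with hφ
  have hφpos : ∀ k : ℕ, 0 < φ ((1 / 2) ^ k) := fun k =>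
    mul_pos (by positivity) (Real.log_pos (Real.one_lt_cosh.mpr (by positivity)))
  -- Monotonicity puts both the k-th and the next policy within the tolerance of level k.
  have hφmono : ∀ k : ℕ, φ ((1 / 2) ^ (k + 1)) ≤ φ ((1 / 2) ^ k) := by
    intro k
    have hk : (1 / 2 : ℝ) ^ (k + 1) ≤ (1 / 2) ^ k := by
      rw [pow_succ]
      have : (0 : ℝ) < (1 / 2) ^ k := by positivity
      linarith
    refine mul_le_mul hk (Real.log_le_log (Real.cosh_pos _) ?_)
      (Real.log_nonneg (Real.one_le_cosh _)) (by positivity)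
    rw [Real.cosh_le_cosh, abs_of_pos (by positivity), abs_of_pos (by positivity)]
    gcongr
  have hφcont : Continuous φ :=
    continuous_id.mul ((Real.continuous_cosh.comp (continuous_id.div_const 2)).log
      fun x => (Real.cosh_pos _).ne')
  have hδ : Tendsto (fun k : ℕ => ENNReal.ofReal (φ ((1 / 2) ^ k))) atTop (𝓝 0) := by
    have h := ENNReal.tendsto_ofReal ((hφcont.tendsto 0).comp
      (tendsto_pow_atTop_nhds_zero_of_lt_one (r := (1 / 2 : ℝ)) (by norm_num) (by norm_num)))
    simpa [hφ] using h
  choose p hp hpM using fun k : ℕ => happrox (ENNReal.ofReal (φ ((1 / 2) ^ k)))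
    (by simpa using hφpos k)
  refine ⟨limPolicy p, limPolicy_mem_powerPolicies hp, fun q hq => (hle q hq).trans ?_⟩
  refine le_policyRate_limPolicy hH hp (ae_tendsto_of_summable_steps fun k => ?_) hδ hpM
  refine meas_le_abs_sub_logRate_le (by positivity) (hp k).1 (hp (k + 1)).1 ?_
  refine lintegral_log_cosh_le hM hle (hp k) (hp (k + 1)) (hpM k) ((hpM (k + 1)).trans ?_)
  gcongr
  exact hφmono k

end FadingAWGN

theorem mainTheorem9 {𝓢T : Type v} {𝓢R : Type w}
    [MeasurableSpace 𝓢T] [MeasurableSpace 𝓢R]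
    (Q : Measure (ℂ × 𝓢T × 𝓢R)) [IsProbabilityMeasure Q]
    (hH : ∫⁻ ω, ‖ω.1‖ₑ ^ 2 ∂Q = 1) (P : ℝ≥0) :
    ∃ p ∈ FadingAWGN.powerPolicies Q P,
      (∀ q ∈ FadingAWGN.powerPolicies Q P,
        FadingAWGN.policyRate Q q ≤ FadingAWGN.policyRate Q p) ∧
      FadingAWGN.policyRate Q p < ∞ ∧
      FadingAWGN.capacity.{u, v, w} Q P ≤ FadingAWGN.policyRate Q p := by
  obtain ⟨p, hp, hmax⟩ := FadingAWGN.exists_isMax_policyRate hH P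
  refine ⟨p, hp, hmax, (FadingAWGN.policyRate_le hH hp).trans_lt (by simp), ?_⟩
  refine iSup₂_le fun A hA => ?_
  exact (A.condMutualInfo_le_policyRate hH hA).trans (hmax _ (A.policy_mem_powerPolicies hA))
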